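/- Let $m\ge 1$ and let $S_0,\dots,S_m:\mathbb R\to\mathbb R$ be similarities with a common contraction factor $\rho\in(0,1)$, i.e. $|S_j(x)-S_j(y)|=\rho|x-y|$ for all $x,y\in\mathbb R$ and all $j$. For a word $w=(j_1,\dots,j_n)$ on $\{0,\dots,m\}$ put $S_w=S_{j_1}\circ\cdots\circ S_{j_n}$, and let $K$ be the self-similar set of the system, i.e. the unique non-empty compact set with $K=\bigcup_{j}S_j(K)$. Assume that the system is of finite type: there is a finite set $F\subseteq\mathbb R$ such that for every $n$ and all words $v,w$ of length $n$, either $|S_v(0)-S_w(0)|>\rho^n\operatorname{diam}K$ or $\rho^{-n}|S_v(0)-S_w(0)|\in F$. Let $p_0,\dots,p_m>0$ with $\sum_j p_j=1$, and let $\mu$ be the associated self-similar measure, i.e. the unique Borel probability measure on $\mathbb R$ with $\mu(E)=\sum_{j}p_j\,\mu(S_j^{-1}(E))$ for all Borel sets $E$. Assume that $\operatorname{supp}\mu=[0,1]$. Then for every constant dimension function $\Phi=\delta>0$ the upper $\Phi$-dimension of $\mu$ satisfies $\overline{\dim}_\Phi\mu<\infty$. Here a dimension function is a map $\Phi:(0,1)\to[0,\infty)$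 such that $x^{1+\Phi(x)}$ decreases to $0$ as $x$ decreases to $0$, and $\overline{\dim}_\Phi\mu$ is the infimum (equal to $+\infty$ if there is no such $\alpha$) of all $\alpha\in\mathbb R$ for which there are constants $C_1,C_2>0$ such that $$\frac{\mu(B(x,R))}{\mu(B(x,r))}\le C_2\left(\frac Rr\right)^{\alpha}$$ for all $x\in\operatorname{supp}\mu$, all $R\in(0,1)$ and all $r$ with $0<r<R^{1+\Phi(R)}\le R\le C_1$, where $B(x,R)$ denotes the open ball. -/

import Mathlib

namespace PhiDim

open Set Filter Topology MeasureTheory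

/-- A dimension function: a map `Φ : (0,1) → [0,∞)` such that `x ^ (1 + Φ x)` decreases to `0`
as `x` decreases to `0`. -/
structure DimensionFunction where
  toFun : Ioo (0 : ℝ) 1 → ℝ
  nonneg : ∀ x, 0 ≤ toFun x
  monotone : Monotone fun x : Ioo (0 : ℝ) 1 => (x : ℝ) ^ (1 + toFun x)
  tendsto_zero : Tendsto (fun x : Ioo (0 : ℝ) 1 => (x : ℝ) ^ (1 + toFun x))
    (comap ((↑) : Ioo (0 : ℝ) 1 → ℝ) (𝓝 0)) (𝓝 0)

/-- The constant dimension function `Φ = δ`, for `δ ≥ 0`. -/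
def DimensionFunction.const (δ : ℝ) (hδ : 0 ≤ δ) : DimensionFunction where
  toFun := fun _ => δ
  nonneg := fun _ => hδ
  monotone := fun x y hxy => by
    have hx : (0 : ℝ) ≤ x := x.2.1.le
    have hxy' : (x : ℝ) ≤ y := hxy
    exact Real.rpow_le_rpow hx hxy' (by linarith)
  tendsto_zero := by
    have h : Tendsto (fun t : ℝ => t ^ (1 + δ)) (𝓝 0) (𝓝 ((0 : ℝ) ^ (1 + δ))) :=
      (Real.continuousAt_rpow_const 0 (1 + δ) (Or.inr (by linarith))).tendsto
    rw [Real.zero_rpow (by linarith)] at h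
    exact h.comp tendsto_comap

/-- The upper `Φ`-dimension of a measure: the infimum, in the extended reals, of the real `α` for
which there are `C₁, C₂ > 0` with `μ (B(x,R)) / μ (B(x,r)) ≤ C₂ (R/r) ^ α` for all
`0 < r < R ^ (1 + Φ R) ≤ R ≤ C₁` and all `x` in the support of `μ`. It is `⊤` if there is no
such `α`. -/
noncomputable def upperPhiDim {X : Type*} [MetricSpace X] [MeasurableSpace X]
    (Φ : DimensionFunction) (μ : Measure X) : EReal :=
  sInf {a : EReal | ∃ α : ℝ, a = (α : EReal) ∧
    ∃ C₁ : ℝ, 0 < C₁ ∧ ∃ C₂ : ℝ, 0 < C₂ ∧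
      ∀ (R : Ioo (0 : ℝ) 1) (r : ℝ), 0 < r → r < (R : ℝ) ^ (1 + Φ.toFun R) →
        (R : ℝ) ^ (1 + Φ.toFun R) ≤ R → (R : ℝ) ≤ C₁ →
        ∀ x ∈ μ.support,
          μ.real (Metric.ball x R) / μ.real (Metric.ball x r) ≤ C₂ * ((R : ℝ) / r) ^ α}

/-- An iterated function system `S_0, …, S_m` of contracting similarities of `X`. -/
structure SimilarityIFS (X : Type*) [MetricSpace X] (m : ℕ) where
  map : Fin (m + 1) → X → X
  ratio : Fin (m + 1) → ℝ
  ratio_pos : ∀ j, 0 < ratio j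
  ratio_lt_one : ∀ j, ratio j < 1
  dist_map : ∀ j x y, dist (map j x) (map j y) = ratio j * dist x y

namespace SimilarityIFS

variable {X : Type*} [MetricSpace X] {m : ℕ}

/-- `S_w = S_{j_1} ∘ ⋯ ∘ S_{j_n}` for the word `w = (j_1, …, j_n)`. -/
def wordMap (S : SimilarityIFS X m) : List (Fin (m + 1)) → X → X
  | [] => id
  | j :: w => S.map j ∘ S.wordMap w

/-- All the similarities have the same contraction factor `ρ`. -/
def IsEquicontractive (S : SimilarityIFS X m) (ρ : ℝ) : Prop :=
  ∀ j, S.ratio j = ρ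

/-- `K` is the self-similar set of the IFS. -/
def IsSelfSimilarSet (S : SimilarityIFS X m) (K : Set X) : Prop :=
  K.Nonempty ∧ IsCompact K ∧ K = ⋃ j, S.map j '' K

/-- `μ` is the self-similar measure of the IFS `S` and the probabilities `p`. -/
structure IsSelfSimilarMeasure [MeasurableSpace X] (S : SimilarityIFS X m)
    (p : Fin (m + 1) → ℝ) (μ : Measure X) : Prop where
  prob_pos : ∀ j, 0 < p j
  sum_prob : ∑ j, p j = 1
  isProbabilityMeasure : IsProbabilityMeasure μ
  measure_eq : ∀ E : Set X, MeasurableSet E →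
    μ E = ∑ j, ENNReal.ofReal (p j) * μ (S.map j ⁻¹' E)

/-- The finite type condition, for an IFS on `ℝ` whose maps all have contraction factor `ρ`. -/
def IsFiniteType (S : SimilarityIFS ℝ m) (ρ : ℝ) : Prop :=
  ∃ K : Set ℝ, S.IsSelfSimilarSet K ∧ ∃ F : Set ℝ, F.Finite ∧
    ∀ (n : ℕ) (v w : List (Fin (m + 1))), v.length = n → w.length = n →
      Metric.diam K * ρ ^ n < |S.wordMap v 0 - S.wordMap w 0| ∨
        (ρ ^ n)⁻¹ * |S.wordMap v 0 - S.wordMap w 0| ∈ F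

end SimilarityIFS

end PhiDim

namespace PhiDim

open Set Filter Topology MeasureTheory

namespace SimilarityIFS

/-! The numerator `μ(B(x,R))` is at most 1, so a polynomial lower bound on `μ(B(x,r))` suffices. For
every `n`, a point of the support lies in a level-`n` copy of the support, of diameter at most `ρ ^
n` and mass at least `(min p) ^ n`; this yields `μ(B(x,r)) ≥ c * r ^ k`
(`exists_mul_pow_le_measureReal_ball`). As `r < R ^ (1 + δ)` with `δ > 0`, the ratio `R / r` is at
least a negative power of `r`, so it controls `r ^ (-k)` (`inv_pow_le_div_rpow`). -/

theorem continuous_map {X : Type*} [MetricSpace X] {m : ℕ} (S : SimilarityIFS X m)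
    (j : Fin (m + 1)) : Continuous (S.map j) :=
  (LipschitzWith.of_dist_le_mul (K := (S.ratio j).toNNReal) fun x y => by
    rw [S.dist_map, Real.coe_toNNReal _ (S.ratio_pos j).le]).continuous

theorem preimage_closedBall {X : Type*} [MetricSpace X] {m : ℕ} (S : SimilarityIFS X m)
    (j : Fin (m + 1)) (y : X) (t : ℝ) :
    S.map j ⁻¹' Metric.closedBall (S.map j y) (S.ratio j * t) = Metric.closedBall y t := by
  ext z
  simp only [mem_preimage, Metric.mem_closedBall, S.dist_map]
  exact mul_le_mul_iff_right₀ (S.ratio_pos j)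

/-- A compact support of a self-similar measure is covered by its images under the maps of the
system. -/
theorem IsSelfSimilarMeasure.support_subset_iUnion_image {X : Type*} [MetricSpace X]
    [HereditarilyLindelofSpace X] [MeasurableSpace X] [BorelSpace X] {m : ℕ}
    {S : SimilarityIFS X m} {p : Fin (m + 1) → ℝ} {μ : Measure X}
    (hμ : S.IsSelfSimilarMeasure p μ) (hc : IsCompact μ.support) :
    μ.support ⊆ ⋃ j, S.map j '' μ.support := by
  have hclosed : IsClosed (⋃ j, S.map j '' μ.support) :=
    (isCompact_iUnion fun j => hc.image (S.continuous_map j)).isClosed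
  refine Measure.support_subset_of_isClosed hclosed ?_
  rw [mem_ae_iff, hμ.measure_eq _ hclosed.measurableSet.compl]
  -- Each `S_j`-preimage of the complement misses the support, hence is null.
  refine Finset.sum_eq_zero fun j _ => ?_
  rw [measure_mono_null _ (mem_ae_iff.1 (Measure.support_mem_ae (μ := μ))), mul_zero]
  intro x hx hxs
  exact hx (mem_iUnion.2 ⟨j, mem_image_of_mem _ hxs⟩)

/-- An equicontractive self-similar measure whose support has diameter at most one gives mass at
least `q ^ n` to the balls of radius `ρ ^ n` centred in its support, if `q` is a lower bound of the
probabilities. -/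
theorem IsSelfSimilarMeasure.pow_le_measure_closedBall {X : Type*} [MetricSpace X]
    [HereditarilyLindelofSpace X] [MeasurableSpace X] [BorelSpace X] {m : ℕ}
    {S : SimilarityIFS X m} {p : Fin (m + 1) → ℝ} {μ : Measure X} {ρ q : ℝ}
    (hμ : S.IsSelfSimilarMeasure p μ) (hS : S.IsEquicontractive ρ) (hc : IsCompact μ.support)
    (hdiam : ∀ x ∈ μ.support, ∀ y ∈ μ.support, dist x y ≤ 1) (hq : ∀ j, q ≤ p j) (n : ℕ) :
    ∀ x ∈ μ.support, ENNReal.ofReal q ^ n ≤ μ (Metric.closedBall x (ρ ^ n)) := by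
  have := hμ.isProbabilityMeasure
  induction n with
  | zero =>
    intro x hx
    rw [pow_zero, pow_zero]
    refine ((prob_compl_eq_zero_iff (Metric.isClosed_closedBall (x := x) (ε := 1)).measurableSet).1
      (measure_mono_null (compl_subset_compl.2 fun y hy => ?_)
        (mem_ae_iff.1 (Measure.support_mem_ae (μ := μ))))).ge
    exact hdiam y hy x hx
  | succ n ih =>
    intro x hx
    obtain ⟨j, y, hy, rfl⟩ := mem_iUnion.1 (hμ.support_subset_iUnion_image hc hx)
    rw [hμ.measure_eq _ Metric.isClosed_closedBall.measurableSet, pow_succ', pow_succ', ← hS j]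
    -- Keep only the term of the map `j` with `x = S_j y`: its preimage of the ball is the ball of
    -- radius `ρ ^ n` about `y`.
    refine le_trans ?_ (Finset.single_le_sum (f := fun i => ENNReal.ofReal (p i) *
      μ (S.map i ⁻¹' Metric.closedBall (S.map j y) (S.ratio j * S.ratio j ^ n)))
      (fun _ _ => zero_le) (Finset.mem_univ j))
    rw [S.preimage_closedBall, hS j]
    exact mul_le_mul' (ENNReal.ofReal_le_ofReal (hq j)) (ih y hy)

/-- The lower mass bound: the measure of a ball centred in the support is bounded below by a power
of the radius. -/
theorem IsSelfSimilarMeasure.exists_mul_pow_le_measureReal_ball {X : Type*} [MetricSpace X]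
    [HereditarilyLindelofSpace X] [MeasurableSpace X] [BorelSpace X] {m : ℕ}
    {S : SimilarityIFS X m} {p : Fin (m + 1) → ℝ} {μ : Measure X} {ρ : ℝ}
    (hμ : S.IsSelfSimilarMeasure p μ) (hS : S.IsEquicontractive ρ) (hc : IsCompact μ.support)
    (hdiam : ∀ x ∈ μ.support, ∀ y ∈ μ.support, dist x y ≤ 1) :
    ∃ c : ℝ, 0 < c ∧ ∃ k : ℕ, ∀ r : ℝ, 0 < r → r ≤ 1 → ∀ x ∈ μ.support,
      c * r ^ k ≤ μ.real (Metric.ball x r) := by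
  have := hμ.isProbabilityMeasure
  have hρ0 : 0 < ρ := hS 0 ▸ S.ratio_pos 0
  have hρ1 : ρ < 1 := hS 0 ▸ S.ratio_lt_one 0
  obtain ⟨i, hi⟩ := Finite.exists_min p
  have hp := hμ.prob_pos i
  -- With `ρ ^ k < min p`, the bound `r ≤ ρ ^ n` gives `r ^ k ≤ (min p) ^ n`. The constant `c = min
  -- p` pays for using level `n + 1`, where `ρ ^ (n + 1) < r`.
  obtain ⟨k, hk⟩ := exists_pow_lt_of_lt_one hp hρ1
  refine ⟨p i, hp, k, fun r hr0 hr1 x hx => ?_⟩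
  obtain ⟨n, hn1, hn2⟩ := exists_nat_pow_near_of_lt_one hr0 hr1 hρ0 hρ1
  have hball := (hμ.pow_le_measure_closedBall hS hc hdiam hi (n + 1) x hx).trans
    (measure_mono (Metric.closedBall_subset_ball hn1))
  rw [← ENNReal.ofReal_pow hp.le, ENNReal.ofReal_le_iff_le_toReal (measure_ne_top _ _)] at hball
  refine le_trans ?_ hball
  rw [pow_succ']
  refine mul_le_mul_of_nonneg_left ?_ hp.le
  calc r ^ k ≤ (ρ ^ n) ^ k := pow_le_pow_left₀ hr0.le hn2 k
    _ = (ρ ^ k) ^ n := pow_right_comm ρ n k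
    _ ≤ p i ^ n := pow_le_pow_left₀ (by positivity) hk.le n

end SimilarityIFS

/-- Dividing `r ≤ R ^ (1 + δ)` by `r ^ (1 + δ)` gives `r ^ (-δ) ≤ (R / r) ^ (1 + δ)`; then raise to
the power `k / δ`. -/
theorem inv_pow_le_div_rpow {R r δ : ℝ} (hR : 0 < R) (hr : 0 < r) (hδ : 0 < δ)
    (h : r ≤ R ^ (1 + δ)) (k : ℕ) : (r ^ k)⁻¹ ≤ (R / r) ^ ((1 + δ) * (k / δ)) := by
  have h1 : r ^ (-δ) ≤ (R / r) ^ (1 + δ) := by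
    rw [Real.div_rpow hR.le hr.le, le_div_iff₀ (by positivity), ← Real.rpow_add hr]
    simpa using h
  rw [Real.rpow_mul (by positivity)]
  refine le_trans (le_of_eq ?_) (Real.rpow_le_rpow (by positivity) h1 (by positivity))
  rw [← Real.rpow_mul hr.le, show -δ * (k / δ) = -(k : ℝ) by field_simp, Real.rpow_neg hr.le,
    Real.rpow_natCast]

/-- A probability measure satisfying a lower mass bound has finite upper `Φ`-dimension for every
constant `Φ = δ > 0`. -/
theorem upperPhiDim_const_lt_top {X : Type*} [MetricSpace X] [MeasurableSpace X] {μ : Measure X}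
    [IsProbabilityMeasure μ] {c : ℝ} (hc : 0 < c) {k : ℕ}
    (hμ : ∀ r : ℝ, 0 < r → r ≤ 1 → ∀ x ∈ μ.support, c * r ^ k ≤ μ.real (Metric.ball x r))
    {δ : ℝ} (hδ : 0 < δ) : upperPhiDim (DimensionFunction.const δ hδ.le) μ < ⊤ := by
  refine lt_of_le_of_lt (sInf_le ⟨(1 + δ) * (k / δ), rfl, 1, one_pos, c⁻¹, inv_pos.2 hc, ?_⟩)
    (EReal.coe_lt_top _)
  intro R r hr hrR hRR _ x hx
  calc μ.real (Metric.ball x R) / μ.real (Metric.ball x r) ≤ 1 / (c * r ^ k) :=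
        div_le_div₀ zero_le_one measureReal_le_one (by positivity)
          (hμ r hr ((hrR.le.trans hRR).trans R.2.2.le) x hx)
    _ = c⁻¹ * (r ^ k)⁻¹ := by rw [one_div, mul_inv]
    _ ≤ c⁻¹ * ((R : ℝ) / r) ^ ((1 + δ) * (k / δ)) :=
        mul_le_mul_of_nonneg_left (inv_pow_le_div_rpow R.2.1 hr hδ hrR.le k) (by positivity)

end PhiDim

theorem mainTheorem10 {m : ℕ} (hm : 1 ≤ m) (S : PhiDim.SimilarityIFS ℝ m) (ρ : ℝ)
    (hS : S.IsEquicontractive ρ) (hF : S.IsFiniteType ρ)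
    (p : Fin (m + 1) → ℝ) (μ : MeasureTheory.Measure ℝ) (hμ : S.IsSelfSimilarMeasure p μ)
    (hsupp : μ.support = Set.Icc (0 : ℝ) 1) (δ : ℝ) (hδ : 0 < δ) :
    PhiDim.upperPhiDim (PhiDim.DimensionFunction.const δ hδ.le) μ < ⊤ := by
  have := hμ.isProbabilityMeasure
  have hdiam : ∀ x ∈ μ.support, ∀ y ∈ μ.support, dist x y ≤ 1 := by
    rw [hsupp]
    exact fun x hx y hy => Real.dist_le_of_mem_Icc_01 hx hy
  obtain ⟨c, hc, k, hk⟩ :=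
    hμ.exists_mul_pow_le_measureReal_ball hS (hsupp ▸ isCompact_Icc) hdiam
  exact PhiDim.upperPhiDim_const_lt_top hc hk hδ
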